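/- Let $d\in\mathbb N$, and for $0<a<b$ let $\mathcal C=\{\xi\in\mathbb R^d: a\le|\xi|\le b\}$, where $|\cdot|$ is the Euclidean norm. Let $k,c,c_1>0$. There is a threshold $M>0$, depending only on $d,a,b,k,c,c_1$, such that the following holds for every $c_2\ge M$. Let $\varphi,\psi\in C^\infty(\mathbb R^d;\mathbb R)$ vanish outside $\mathcal C$. For $\gamma\ge 0$ and $\lambda_1,\lambda_2>0$ put $$\sigma(\xi,\eta)=e^{\gamma(c|\xi+\eta|-c_1|\xi|-c_2|\eta|)}\,\varphi(\xi/\lambda_1)\,\psi(\eta/\lambda_2),$$ and let $$\mathcal B(f,g)(x)=\iint_{\mathbb R^d\times\mathbb R^d}K(y,z)\,f(x-y)\,g(x-z)\,dy\,dz,\qquad K(y,z)=\frac1{(2\pi)^{2d}}\iint_{\mathbb R^d\times\mathbb R^d} e^{i(y\cdot\xi+z\cdot\eta)}\sigma(\xi,\eta)\,d\xi\,d\eta,$$ be the bilinear multiplier with symbol $\sigma$; for $f,g\in L^1(\mathbb R^d)$ it equals $(2\pi)^{-2d}\iint e^{ix\cdot(\xi+\eta)}\sigma(\xi,\eta)\hat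 f(\xi)\hat g(\eta)\,d\xi\,d\eta$, where $\hat f(\xi)=\int f(x)e^{-ix\cdot\xi}\,dx$. Then for all $1\le p,q,r\le\infty$ with $\frac1p+\frac1q=\frac1r$ there is a constant $C$, independent of $\gamma,\lambda_1,\lambda_2$ (and of $f,g$), such that whenever $\gamma\ge0$, $\lambda_1,\lambda_2>0$, $\lambda_1\le k\lambda_2$, $f\in L^p(\mathbb R^d)$ and $g\in L^q(\mathbb R^d)$, the integral defining $\mathcal B(f,g)(x)$ converges absolutely for almost every $x$, $\mathcal B(f,g)\in L^r(\mathbb R^d)$, and $$\|\mathcal B(f,g)\|_{L^r}\le C\,\|f\|_{L^p}\,\|g\|_{L^q}.$$ -/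

import Mathlib

open MeasureTheory
open scoped ENNReal NNReal ContDiff

noncomputable section

/-- The annulus `𝒞(0, a, b) = {ξ ∈ ℝᵈ : a ≤ |ξ| ≤ b}` (Euclidean norm). -/
def annulus (d : ℕ) (a b : ℝ) : Set (EuclideanSpace ℝ (Fin d)) :=
  {ξ | a ≤ ‖ξ‖ ∧ ‖ξ‖ ≤ b}

/-- The Gevrey symbol `m(ξ, η) = exp (γ (c |ξ + η| - c₁ |ξ| - c₂ |η|))`. -/
def gevreySymbol {d : ℕ} (γ c c₁ c₂ : ℝ)
    (v : EuclideanSpace ℝ (Fin d) × EuclideanSpace ℝ (Fin d)) : ℂ :=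
  (Real.exp (γ * (c * ‖v.1 + v.2‖ - c₁ * ‖v.1‖ - c₂ * ‖v.2‖)) : ℝ)

/-- The symbol `σ` localized by cutoffs: `σ(ξ, η) φ(ξ / ℓ₁) ψ(η / ℓ₂)`. -/
def localizedSymbol {d : ℕ}
    (σ : EuclideanSpace ℝ (Fin d) × EuclideanSpace ℝ (Fin d) → ℂ)
    (φ ψ : EuclideanSpace ℝ (Fin d) → ℝ) (ℓ₁ ℓ₂ : ℝ)
    (v : EuclideanSpace ℝ (Fin d) × EuclideanSpace ℝ (Fin d)) : ℂ :=
  σ v * (φ (ℓ₁⁻¹ • v.1) : ℂ) * (ψ (ℓ₂⁻¹ • v.2) : ℂ)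

/-- The Fourier transform `∫ f(x) e^{-i x·ξ} dx`. -/
def angularFourier {d : ℕ} (f : EuclideanSpace ℝ (Fin d) → ℂ)
    (ξ : EuclideanSpace ℝ (Fin d)) : ℂ :=
  ∫ x, Complex.exp (-(Complex.I * ((inner ℝ x ξ : ℝ) : ℂ))) * f x

/-- The convolution kernel of the bilinear multiplier with symbol `σ`:
`K(y, z) = (2π)^{-2d} ∬ e^{i (y·ξ + z·η)} σ(ξ, η) dξ dη`. -/
def bilinearKernel {d : ℕ}
    (σ : EuclideanSpace ℝ (Fin d) × EuclideanSpace ℝ (Fin d) → ℂ)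
    (w : EuclideanSpace ℝ (Fin d) × EuclideanSpace ℝ (Fin d)) : ℂ :=
  (((2 * Real.pi) ^ (2 * d) : ℝ) : ℂ)⁻¹ *
    ∫ v : EuclideanSpace ℝ (Fin d) × EuclideanSpace ℝ (Fin d),
      Complex.exp (Complex.I * ((inner ℝ w.1 v.1 + inner ℝ w.2 v.2 : ℝ) : ℂ)) * σ v

/-- The bilinear multiplier with symbol `σ`,
`B(f, g)(x) = ∬ K(y, z) f(x - y) g(x - z) dy dz`.
`bilinearMultiplier_eq_fourier` identifies it with
`(2π)^{-2d} ∬ e^{i x·(ξ + η)} σ(ξ, η) f̂(ξ) ĝ(η) dξ dη` when `σ, f, g` are integrable; the kernel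
form makes sense for all `f ∈ L^p`, `g ∈ L^q` as soon as the kernel is integrable. -/
def bilinearMultiplier {d : ℕ}
    (σ : EuclideanSpace ℝ (Fin d) × EuclideanSpace ℝ (Fin d) → ℂ)
    (f g : EuclideanSpace ℝ (Fin d) → ℂ) (x : EuclideanSpace ℝ (Fin d)) : ℂ :=
  ∫ w : EuclideanSpace ℝ (Fin d) × EuclideanSpace ℝ (Fin d),
    bilinearKernel σ w * f (x - w.1) * g (x - w.2)

theorem integral_exp_inner_mul_comp_sub {d : ℕ} (f : EuclideanSpace ℝ (Fin d) → ℂ)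
    (x ξ : EuclideanSpace ℝ (Fin d)) :
    ∫ y, Complex.exp (Complex.I * ((inner ℝ y ξ : ℝ) : ℂ)) * f (x - y) =
      Complex.exp (Complex.I * ((inner ℝ x ξ : ℝ) : ℂ)) * angularFourier f ξ := by
  unfold angularFourier
  rw [← integral_const_mul,
    ← integral_sub_left_eq_self (fun y => Complex.exp (Complex.I * ((inner ℝ x ξ : ℝ) : ℂ)) *
      (Complex.exp (-(Complex.I * ((inner ℝ y ξ : ℝ) : ℂ))) * f y)) volume x]
  congr 1
  funext y
  rw [← mul_assoc, ← Complex.exp_add, inner_sub_left]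
  congr 2
  push_cast
  ring

/-- The kernel form of the bilinear multiplier agrees with the frequency-side formula. -/
theorem bilinearMultiplier_eq_fourier {d : ℕ}
    (σ : EuclideanSpace ℝ (Fin d) × EuclideanSpace ℝ (Fin d) → ℂ)
    (f g : EuclideanSpace ℝ (Fin d) → ℂ)
    (hσ : Integrable σ) (hf : Integrable f) (hg : Integrable g)
    (x : EuclideanSpace ℝ (Fin d)) :
    bilinearMultiplier σ f g x =
      (((2 * Real.pi) ^ (2 * d) : ℝ) : ℂ)⁻¹ *
        ∫ v : EuclideanSpace ℝ (Fin d) × EuclideanSpace ℝ (Fin d),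
          Complex.exp (Complex.I * ((inner ℝ x (v.1 + v.2) : ℝ) : ℂ)) * σ v *
            angularFourier f v.1 * angularFourier g v.2 := by
  have hf' : Integrable (fun y => f (x - y)) := hf.comp_sub_left x
  have hg' : Integrable (fun y => g (x - y)) := hg.comp_sub_left x
  have hfg : Integrable (fun w : EuclideanSpace ℝ (Fin d) × EuclideanSpace ℝ (Fin d) =>
      f (x - w.1) * g (x - w.2)) := hf'.mul_prod hg'
  have hall : Integrable (fun u : (EuclideanSpace ℝ (Fin d) × EuclideanSpace ℝ (Fin d)) ×
      (EuclideanSpace ℝ (Fin d) × EuclideanSpace ℝ (Fin d)) =>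
      Complex.exp (Complex.I *
        ((inner ℝ u.1.1 u.2.1 + inner ℝ u.1.2 u.2.2 : ℝ) : ℂ)) *
        ((f (x - u.1.1) * g (x - u.1.2)) * σ u.2)) (volume.prod volume) := by
    refine (hfg.mul_prod hσ).bdd_mul (c := 1) ?_ ?_
    · exact Continuous.aestronglyMeasurable (by fun_prop)
    · refine Filter.Eventually.of_forall fun u => ?_
      rw [mul_comm, Complex.norm_exp_ofReal_mul_I]
  have hswap := integral_integral_swap
    (f := fun w v : EuclideanSpace ℝ (Fin d) × EuclideanSpace ℝ (Fin d) =>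
      Complex.exp (Complex.I * ((inner ℝ w.1 v.1 + inner ℝ w.2 v.2 : ℝ) : ℂ)) *
        ((f (x - w.1) * g (x - w.2)) * σ v)) hall
  have hL : bilinearMultiplier σ f g x = (((2 * Real.pi) ^ (2 * d) : ℝ) : ℂ)⁻¹ *
      ∫ w : EuclideanSpace ℝ (Fin d) × EuclideanSpace ℝ (Fin d),
        ∫ v : EuclideanSpace ℝ (Fin d) × EuclideanSpace ℝ (Fin d),
          Complex.exp (Complex.I * ((inner ℝ w.1 v.1 + inner ℝ w.2 v.2 : ℝ) : ℂ)) *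
            ((f (x - w.1) * g (x - w.2)) * σ v) := by
    unfold bilinearMultiplier bilinearKernel
    rw [← integral_const_mul]
    congr 1
    funext w
    rw [mul_assoc, mul_assoc, ← integral_mul_const]
    congr 2
    funext v
    ring
  rw [hL, hswap]
  congr 2
  funext v
  have h1 := integral_prod_mul (μ := (volume : Measure (EuclideanSpace ℝ (Fin d))))
    (ν := (volume : Measure (EuclideanSpace ℝ (Fin d))))
    (fun y => Complex.exp (Complex.I * ((inner ℝ y v.1 : ℝ) : ℂ)) * f (x - y))
    (fun z => Complex.exp (Complex.I * ((inner ℝ z v.2 : ℝ) : ℂ)) * g (x - z))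
  rw [integral_exp_inner_mul_comp_sub, integral_exp_inner_mul_comp_sub] at h1
  have h2 : ∀ w : EuclideanSpace ℝ (Fin d) × EuclideanSpace ℝ (Fin d),
      Complex.exp (Complex.I * ((inner ℝ w.1 v.1 + inner ℝ w.2 v.2 : ℝ) : ℂ)) *
        ((f (x - w.1) * g (x - w.2)) * σ v) =
      (Complex.exp (Complex.I * ((inner ℝ w.1 v.1 : ℝ) : ℂ)) * f (x - w.1) *
        (Complex.exp (Complex.I * ((inner ℝ w.2 v.2 : ℝ) : ℂ)) * g (x - w.2))) * σ v := by
    intro w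
    push_cast
    rw [mul_add, Complex.exp_add]
    ring
  simp_rw [h2]
  rw [integral_mul_const]
  refine (congrArg (· * σ v) h1).trans ?_
  rw [inner_add_right]
  push_cast
  rw [mul_add, Complex.exp_add]
  ring

end

/-!
The symbol is an exponential, so its kernel is estimated in a Wiener algebra. Write
`σ(ξ, η) = e^{γ c |ξ + η|} · e^{-γ c₁ |ξ|} φ(ξ / ℓ₁) · e^{-γ c₂ |η|} ψ(η / ℓ₂)`.

The last two factors are smooth bumps on annuli. Seminorm estimates in Schwartz space show that
their kernels have `L¹` norm `O(1)` and `O(e^{-γ c₂ ℓ₂ a / 2})`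
(`exists_linearKernelMass_exp_neg_norm_mul_le`), and these norms do not see the dilations by `ℓ₁`
and `ℓ₂` (`linearKernelMass_comp_smul`).

The first factor is singular where `ξ + η = 0`, which happens on the support when `ℓ₁` and `ℓ₂` are
comparable. Since `ℓ₁ ≤ k ℓ₂`, on the support `|ξ + η| ≤ R ℓ₂` with `R = (k + 1) b`, so
`|ξ + η| / ℓ₂` may be replaced by `h((ξ + η) / ℓ₂)` for any `h` that equals the norm on the ball of
radius `R`. A cutoff `h` of the norm is a sum of dyadic pieces `2^{-j} θ(2^j ·)` with `θ` smooth and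
compactly supported; all `θ(2^j ·)` have the same Wiener norm, so `h` has a finite Wiener norm `A`
(`exists_isMassMultiplier_norm_add`). The exponential series then bounds the Wiener norm of
`e^{γ c ℓ₂ h}` by `e^{γ c ℓ₂ A}` (`IsMassMultiplier.exp`), uniformly in all parameters, and the
decay of the factor in `η` beats this growth as soon as `c A ≤ c₂ a / 2`. No derivative of the full
symbol is ever estimated.

Given a uniform `L¹` bound on the kernel, the bounds from `L^p × L^q` to `L^r` follow from
Minkowski's and Hölder's inequalities (`memLp_bilinear_convolution`).
-/

/-! ### Symbols acting on kernels by bounded superpositions of translations -/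

section OscillatoryIntegral

variable {V : Type*} [NormedAddCommGroup V] [InnerProductSpace ℝ V] [FiniteDimensional ℝ V]
  [MeasurableSpace V] [BorelSpace V]

/-- The inverse Fourier integral `∬ e^{i (y·ξ + z·η)} σ(ξ, η) dξ dη` at `w = (y, z)`, without the
factor `(2π)^{-2d}`. -/
noncomputable def oscInt (σ : V × V → ℂ) (w : V × V) : ℂ :=
  ∫ v : V × V, Complex.exp (Complex.I * ((inner ℝ w.1 v.1 + inner ℝ w.2 v.2 : ℝ) : ℂ)) * σ v

/-- The `L¹` norm of the inverse Fourier integral of a symbol, possibly infinite. -/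
noncomputable def kernelMass (σ : V × V → ℂ) : ℝ≥0∞ := ∫⁻ w, ‖oscInt σ w‖ₑ

theorem norm_exp_I_mul_ofReal (x : ℝ) : ‖Complex.exp (Complex.I * (x : ℂ))‖ = 1 := by
  rw [mul_comm, Complex.norm_exp_ofReal_mul_I]

theorem continuous_oscInt {σ : V × V → ℂ} (hσ : Integrable σ) : Continuous (oscInt σ) := by
  refine continuous_of_dominated (bound := fun v => ‖σ v‖) (fun w => ?_) (fun w => ?_) hσ.norm ?_
  · exact (Continuous.aestronglyMeasurable (by fun_prop)).mul hσ.1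
  · refine Filter.Eventually.of_forall fun v => ?_
    rw [norm_mul, norm_exp_I_mul_ofReal, one_mul]
  · refine Filter.Eventually.of_forall fun v => ?_
    fun_prop

/-- A bounded function `m` such that multiplying an integrable symbol by `m` enlarges the `L¹` norm
of its kernel by a factor of at most `A`. These functions play the role of a Wiener algebra; no
Fourier inversion for measures is needed to work with them. -/
structure IsMassMultiplier (m : V × V → ℂ) (A : ℝ) : Prop where
  measurable : Measurable m
  norm_le : ∀ v, ‖m v‖ ≤ A
  mass_le : ∀ σ : V × V → ℂ, Integrable σ →
    kernelMass (fun v => m v * σ v) ≤ ENNReal.ofReal A * kernelMass σ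

namespace IsMassMultiplier

variable {m n : V × V → ℂ} {A B : ℝ}

theorem nonneg (hm : IsMassMultiplier m A) : 0 ≤ A := (norm_nonneg _).trans (hm.norm_le 0)

theorem integrable_mul (hm : IsMassMultiplier m A) {σ : V × V → ℂ} (hσ : Integrable σ) :
    Integrable (fun v => m v * σ v) :=
  hσ.bdd_mul hm.measurable.aestronglyMeasurable (Filter.Eventually.of_forall hm.norm_le)

theorem one : IsMassMultiplier (fun _ : V × V => (1 : ℂ)) 1 where
  measurable := measurable_const
  norm_le := by simp
  mass_le := by simp

theorem mul (hm : IsMassMultiplier m A) (hn : IsMassMultiplier n B) :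
    IsMassMultiplier (fun v => m v * n v) (A * B) where
  measurable := hm.measurable.mul hn.measurable
  norm_le v := by
    rw [norm_mul]
    exact mul_le_mul (hm.norm_le v) (hn.norm_le v) (norm_nonneg _) hm.nonneg
  mass_le σ hσ := by
    have h := hm.mass_le _ (hn.integrable_mul hσ)
    simp only [mul_assoc]
    refine h.trans ?_
    rw [ENNReal.ofReal_mul hm.nonneg, mul_assoc]
    gcongr
    exact hn.mass_le σ hσ

theorem pow (hm : IsMassMultiplier m A) (k : ℕ) :
    IsMassMultiplier (fun v => m v ^ k) (A ^ k) := by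
  induction k with
  | zero => simpa using one
  | succ k ih => simpa [pow_succ] using ih.mul hm

theorem const_mul (hm : IsMassMultiplier m A) {t : ℝ} (ht : 0 ≤ t) :
    IsMassMultiplier (fun v => (t : ℂ) * m v) (t * A) where
  measurable := hm.measurable.const_mul _
  norm_le v := by
    rw [norm_mul, Complex.norm_real, Real.norm_of_nonneg ht]
    exact mul_le_mul_of_nonneg_left (hm.norm_le v) ht
  mass_le σ hσ := by
    have h : ∀ w, oscInt (fun v => (t : ℂ) * m v * σ v) w =
        (t : ℂ) * oscInt (fun v => m v * σ v) w := fun w => by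
      unfold oscInt
      rw [← integral_const_mul]
      congr 1
      funext v
      ring
    unfold kernelMass
    simp only [h, enorm_mul]
    rw [lintegral_const_mul' _ _ enorm_ne_top, ENNReal.ofReal_mul ht, mul_assoc,
      ← ofReal_norm, Complex.norm_real, Real.norm_of_nonneg ht]
    gcongr
    exact hm.mass_le σ hσ

/-- Absolutely convergent series of multipliers. -/
theorem hasSum {M : ℕ → V × V → ℂ} {a : ℕ → ℝ} (hM : ∀ j, IsMassMultiplier (M j) (a j))
    (ha : HasSum a A) (hm : ∀ v, HasSum (fun j => M j v) (m v)) : IsMassMultiplier m A where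
  measurable := by
    have h : m = fun v => ∑' j, M j v := funext fun v => (hm v).tsum_eq.symm
    refine measurable_of_tendsto_metrizable (f := fun (N : ℕ) v => ∑ j ∈ Finset.range N, M j v)
      (fun N => Finset.measurable_fun_sum _ fun j _ => (hM j).measurable) ?_
    exact tendsto_pi_nhds.2 fun v => (hm v).tendsto_sum_nat
  norm_le v := by
    rw [← (hm v).tsum_eq]
    exact tsum_of_norm_bounded ha fun j => (hM j).norm_le v
  mass_le σ hσ := by
    have hosc : ∀ w, oscInt (fun v => m v * σ v) w = ∑' j, oscInt (fun v => M j v * σ v) w := by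
      intro w
      unfold oscInt
      have hnorm : ∀ j v, ‖Complex.exp (Complex.I *
          ((inner ℝ w.1 v.1 + inner ℝ w.2 v.2 : ℝ) : ℂ)) * (M j v * σ v)‖ ≤ a j * ‖σ v‖ := by
        intro j v
        rw [norm_mul, norm_exp_I_mul_ofReal, one_mul, norm_mul]
        exact mul_le_mul_of_nonneg_right ((hM j).norm_le v) (norm_nonneg _)
      have hint : ∀ j, Integrable (fun v : V × V => Complex.exp (Complex.I *
          ((inner ℝ w.1 v.1 + inner ℝ w.2 v.2 : ℝ) : ℂ)) * (M j v * σ v)) := fun j =>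
        (hσ.norm.const_mul (a j)).mono' ((Continuous.aestronglyMeasurable (by fun_prop)).mul
          ((hM j).integrable_mul hσ).1) (Filter.Eventually.of_forall (hnorm j))
      rw [integral_tsum_of_summable_integral_norm hint]
      · congr 1
        funext v
        rw [tsum_mul_left, tsum_mul_right, (hm v).tsum_eq]
      · refine Summable.of_nonneg_of_le (fun j => integral_nonneg fun v => norm_nonneg _)
          (fun j => ?_) (ha.summable.mul_right (∫ v, ‖σ v‖))
        rw [← integral_const_mul]
        exact integral_mono (hint j).norm (hσ.norm.const_mul (a j)) (hnorm j)
    calc kernelMass (fun v => m v * σ v)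
        ≤ ∫⁻ w, ∑' j, ‖oscInt (fun v => M j v * σ v) w‖ₑ := by
          refine lintegral_mono fun w => ?_
          rw [hosc]
          exact enorm_tsum_le_tsum_enorm
      _ = ∑' j, kernelMass (fun v => M j v * σ v) :=
          lintegral_tsum fun j =>
            (continuous_oscInt ((hM j).integrable_mul hσ)).enorm.measurable.aemeasurable
      _ ≤ ∑' j, ENNReal.ofReal (a j) * kernelMass σ :=
          ENNReal.tsum_le_tsum fun j => (hM j).mass_le σ hσ
      _ = ENNReal.ofReal A * kernelMass σ := by
          rw [ENNReal.tsum_mul_right, ← ha.tsum_eq,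
            ENNReal.ofReal_tsum_of_nonneg (fun j => (hM j).nonneg) ha.summable]

/-- The exponential series of a multiplier. -/
theorem exp (hm : IsMassMultiplier m A) {t : ℝ} (ht : 0 ≤ t) :
    IsMassMultiplier (fun v => Complex.exp (t * m v)) (Real.exp (t * A)) := by
  have hterm : ∀ j : ℕ, IsMassMultiplier (fun v => (((j.factorial : ℝ)⁻¹ : ℝ) : ℂ) *
      ((t : ℂ) * m v) ^ j) ((j.factorial : ℝ)⁻¹ * (t * A) ^ j) := fun j =>
    ((hm.const_mul ht).pow j).const_mul (by positivity)
  refine hasSum hterm ?_ fun v => ?_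
  · rw [Real.exp_eq_exp_ℝ]
    exact NormedSpace.exp_series_hasSum_exp' (𝕂 := ℝ) (t * A)
  · rw [Complex.exp_eq_exp_ℂ]
    have h := NormedSpace.exp_series_hasSum_exp' (𝕂 := ℂ) ((t : ℂ) * m v)
    simpa using h

/-- A superposition `∫ κ(y) e^{i α y·(ξ + η)} dy` of characters acts on kernels by a superposition
of translations, hence with norm at most `∫ |κ|`. -/
theorem of_integral {κ : V → ℂ} (hκ : Integrable κ) (α : ℝ) :
    IsMassMultiplier (fun v : V × V => ∫ y, Complex.exp (Complex.I *
      ((α * inner ℝ y (v.1 + v.2) : ℝ) : ℂ)) * κ y) (∫ y, ‖κ y‖) where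
  measurable := by
    refine Continuous.measurable ?_
    refine continuous_of_dominated (bound := fun y => ‖κ y‖) (fun w => ?_) (fun w => ?_) hκ.norm ?_
    · exact (Continuous.aestronglyMeasurable (by fun_prop)).mul hκ.1
    · refine Filter.Eventually.of_forall fun v => ?_
      rw [norm_mul, norm_exp_I_mul_ofReal, one_mul]
    · refine Filter.Eventually.of_forall fun v => ?_
      fun_prop
  norm_le v := by
    refine (norm_integral_le_integral_norm _).trans_eq ?_
    simp only [norm_mul, norm_exp_I_mul_ofReal, one_mul]
  mass_le σ hσ := by
    have hosc : ∀ w : V × V, oscInt (fun v : V × V => (∫ y, Complex.exp (Complex.I *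
        ((α * inner ℝ y (v.1 + v.2) : ℝ) : ℂ)) * κ y) * σ v) w =
        ∫ y, κ y * oscInt σ (w + (α • y, α • y)) := by
      intro w
      have hint : Integrable (fun u : (V × V) × V => Complex.exp (Complex.I *
          ((inner ℝ w.1 u.1.1 + inner ℝ w.2 u.1.2 + α * inner ℝ u.2 (u.1.1 + u.1.2) : ℝ) : ℂ)) *
          (σ u.1 * κ u.2)) (volume.prod volume) := by
        refine (hσ.mul_prod hκ).bdd_mul (c := 1) ?_ ?_
        · exact Continuous.aestronglyMeasurable (by fun_prop)
        · exact Filter.Eventually.of_forall fun u => (norm_exp_I_mul_ofReal _).le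
      have hswap := integral_integral_swap (f := fun (v : V × V) (y : V) => Complex.exp (Complex.I *
          ((inner ℝ w.1 v.1 + inner ℝ w.2 v.2 + α * inner ℝ y (v.1 + v.2) : ℝ) : ℂ)) *
          (σ v * κ y)) hint
      unfold oscInt
      refine Eq.trans ?_ (hswap.trans ?_)
      · congr 1
        funext v
        rw [mul_left_comm, mul_comm, ← integral_const_mul]
        congr 1
        funext y
        push_cast
        rw [mul_add Complex.I (_ + _), Complex.exp_add]
        ring
      · congr 1
        funext y
        rw [← integral_const_mul]
        congr 1
        funext v
        simp only [Prod.fst_add, Prod.snd_add, inner_add_left, inner_add_right, inner_smul_left]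
        have h : ∀ e s k : ℂ, e * (s * k) = k * (e * s) := fun e s k => by ring
        rw [h]
        congr 4
        simp
        ring
    have hc := continuous_oscInt hσ
    have hinv : (volume : Measure (V × V)).IsAddRightInvariant := by
      rw [Measure.volume_eq_prod]
      infer_instance
    have hmeas : AEMeasurable (fun u : (V × V) × V =>
        ‖κ u.2‖ₑ * ‖oscInt σ (u.1 + (α • u.2, α • u.2))‖ₑ) (volume.prod volume) :=
      hκ.1.enorm.comp_snd.mul (Continuous.enorm (by fun_prop)).measurable.aemeasurable
    calc kernelMass _
        ≤ ∫⁻ w, ∫⁻ y, ‖κ y‖ₑ * ‖oscInt σ (w + (α • y, α • y))‖ₑ := by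
          refine lintegral_mono fun w => ?_
          simp only [hosc, ← enorm_mul]
          exact enorm_integral_le_lintegral_enorm _
      _ = ∫⁻ y, ∫⁻ w, ‖κ y‖ₑ * ‖oscInt σ (w + (α • y, α • y))‖ₑ :=
          lintegral_lintegral_swap hmeas
      _ = ∫⁻ y, ‖κ y‖ₑ * kernelMass σ := by
          congr 1
          funext y
          rw [lintegral_const_mul' _ _ enorm_ne_top,
            lintegral_add_right_eq_self (fun w => ‖oscInt σ w‖ₑ)]
          rfl
      _ = ENNReal.ofReal (∫ y, ‖κ y‖) * kernelMass σ := by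
          rw [lintegral_mul_const'' _ hκ.1.enorm, ofReal_integral_norm_eq_lintegral_enorm hκ]

end IsMassMultiplier

end OscillatoryIntegral

/-! ### Bilinear convolution with an integrable kernel -/

section Minkowski

/-- The integral Minkowski inequality in the form used for kernels, by Hölder's inequality with
respect to the weight `k`. -/
theorem lintegral_rpow_lintegral_mul_le {W X : Type*} [MeasurableSpace W] [MeasurableSpace X]
    {μ : Measure W} {ν : Measure X} [SFinite μ] [SFinite ν] {k : W → ℝ≥0∞} {F : W → X → ℝ≥0∞}
    (hk : Measurable k) (hF : Measurable (Function.uncurry F)) {s : ℝ} (hs : 1 ≤ s)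
    {B : ℝ≥0∞} (hB : ∀ w, ∫⁻ x, F w x ^ s ∂ν ≤ B ^ s) :
    ∫⁻ x, (∫⁻ w, k w * F w x ∂μ) ^ s ∂ν ≤ ((∫⁻ w, k w ∂μ) * B) ^ s := by
  have hs0 : 0 < s := zero_lt_one.trans_le hs
  have hs1 : s⁻¹ ≤ 1 := inv_le_one_of_one_le₀ hs
  have hpt : ∀ x, (∫⁻ w, k w * F w x ∂μ) ^ s ≤
      (∫⁻ w, k w ∂μ) ^ (s - 1) * ∫⁻ w, k w * F w x ^ s ∂μ := by
    intro x
    have hFx : Measurable fun w => F w x := hF.comp measurable_prodMk_right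
    -- Split `k F = k^{1 - 1/s} (k F^s)^{1/s}`.
    have h := ENNReal.lintegral_mul_norm_pow_le (μ := μ) (f := k) (g := fun w => k w * F w x ^ s)
      hk.aemeasurable (hk.mul (hFx.pow_const s)).aemeasurable
      (sub_nonneg.2 hs1) (inv_nonneg.2 hs0.le) (by ring)
    have h1 : ∀ w, k w ^ (1 - s⁻¹) * (k w * F w x ^ s) ^ s⁻¹ = k w * F w x := by
      intro w
      rw [ENNReal.mul_rpow_of_nonneg _ _ (inv_nonneg.2 hs0.le), ← mul_assoc,
        ← ENNReal.rpow_add_of_nonneg _ _ (sub_nonneg.2 hs1) (inv_nonneg.2 hs0.le),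
        ENNReal.rpow_rpow_inv hs0.ne']
      simp
    simp only [h1] at h
    calc (∫⁻ w, k w * F w x ∂μ) ^ s
        ≤ ((∫⁻ w, k w ∂μ) ^ (1 - s⁻¹) * (∫⁻ w, k w * F w x ^ s ∂μ) ^ s⁻¹) ^ s := by gcongr
      _ = _ := by
        rw [ENNReal.mul_rpow_of_nonneg _ _ hs0.le, ENNReal.rpow_inv_rpow hs0.ne',
          ← ENNReal.rpow_mul]
        congr 2
        field_simp
  have hm : Measurable (Function.uncurry fun w x => k w * F w x ^ s) :=
    (hk.comp measurable_fst).mul (hF.pow_const s)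
  calc ∫⁻ x, (∫⁻ w, k w * F w x ∂μ) ^ s ∂ν
      ≤ ∫⁻ x, (∫⁻ w, k w ∂μ) ^ (s - 1) * ∫⁻ w, k w * F w x ^ s ∂μ ∂ν := lintegral_mono hpt
    _ = (∫⁻ w, k w ∂μ) ^ (s - 1) * ∫⁻ w, ∫⁻ x, k w * F w x ^ s ∂ν ∂μ := by
        have hm' : Measurable fun x => ∫⁻ w, k w * F w x ^ s ∂μ := hm.lintegral_prod_left'
        rw [lintegral_const_mul _ hm', lintegral_lintegral_swap hm.aemeasurable]
    _ ≤ (∫⁻ w, k w ∂μ) ^ (s - 1) * ∫⁻ w, k w * B ^ s ∂μ := by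
        gcongr with w
        have hFw : Measurable fun x => F w x := hF.comp measurable_prodMk_left
        rw [lintegral_const_mul _ (hFw.pow_const s)]
        gcongr
        exact hB w
    _ = ((∫⁻ w, k w ∂μ) * B) ^ s := by
        rw [lintegral_mul_const _ hk, ENNReal.mul_rpow_of_nonneg _ _ hs0.le, ← mul_assoc]
        congr 1
        nth_rewrite 2 [← ENNReal.rpow_one (∫⁻ w, k w ∂μ)]
        rw [← ENNReal.rpow_add_of_nonneg _ _ (sub_nonneg.2 hs) zero_le_one]
        simp

end Minkowski

section BilinearConvolution

variable {V : Type*} [NormedAddCommGroup V] [InnerProductSpace ℝ V] [FiniteDimensional ℝ V]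
  [MeasurableSpace V] [BorelSpace V]

/-- Translates of `f ∈ L^p` and `g ∈ L^q` have a product in `L^r`, with Hölder's bound. -/
theorem eLpNorm_mul_comp_sub_le {p q r : ℝ≥0∞} (hpqr : p⁻¹ + q⁻¹ = r⁻¹) {f g : V → ℂ}
    (hf : AEStronglyMeasurable f) (hg : AEStronglyMeasurable g) (y z : V) :
    eLpNorm (fun x => f (x - y) * g (x - z)) r volume ≤
      eLpNorm f p volume * eLpNorm g q volume := by
  have : ENNReal.HolderTriple p q r := ⟨hpqr⟩
  have hy := measurePreserving_sub_right (volume : Measure V) y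
  have hz := measurePreserving_sub_right (volume : Measure V) z
  have h := eLpNorm_le_eLpNorm_mul_eLpNorm'_of_norm (p := p) (q := q) (r := r)
    (hf.comp_measurePreserving hy) (hg.comp_measurePreserving hz) (fun a b : ℂ => a * b) 1
    (Filter.Eventually.of_forall fun x => by simp)
  rw [eLpNorm_comp_measurePreserving hf hy, eLpNorm_comp_measurePreserving hg hz] at h
  simpa using h

/-- The `L^r` bound for the majorant built from the absolute values of all functions. -/
theorem eLpNorm_lintegral_bilinear_le {p q r : ℝ≥0∞} (hr : 1 ≤ r) (hpqr : p⁻¹ + q⁻¹ = r⁻¹)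
    {K : V × V → ℂ} (hK : StronglyMeasurable K) {f g : V → ℂ}
    (hf : StronglyMeasurable f) (hg : StronglyMeasurable g) :
    eLpNorm (fun x => ∫⁻ w : V × V, ‖K w‖ₑ * ‖f (x - w.1) * g (x - w.2)‖ₑ) r volume ≤
      (∫⁻ w, ‖K w‖ₑ) * (eLpNorm f p volume * eLpNorm g q volume) := by
  have hbound := eLpNorm_mul_comp_sub_le hpqr hf.aestronglyMeasurable (f := f) (g := g)
    hg.aestronglyMeasurable
  rcases eq_or_ne r ⊤ with rfl | hrt
  · have hp : p = ⊤ := by simpa using (add_eq_zero.1 (hpqr.trans ENNReal.inv_top)).1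
    have hq : q = ⊤ := by simpa using (add_eq_zero.1 (hpqr.trans ENNReal.inv_top)).2
    subst hp hq
    simp only [eLpNorm_exponent_top]
    refine eLpNormEssSup_le_of_ae_enorm_bound (Filter.Eventually.of_forall fun x => ?_)
    simp only [enorm_eq_self]
    rw [← lintegral_mul_const _ hK.enorm]
    have h1 : ∀ᵐ y : V, ‖f (x - y)‖ₑ ≤ eLpNormEssSup f volume :=
      (Measure.measurePreserving_sub_left volume x).quasiMeasurePreserving.ae
        (enorm_ae_le_eLpNormEssSup f volume)
    have h2 : ∀ᵐ y : V, ‖g (x - y)‖ₑ ≤ eLpNormEssSup g volume :=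
      (Measure.measurePreserving_sub_left volume x).quasiMeasurePreserving.ae
        (enorm_ae_le_eLpNormEssSup g volume)
    refine lintegral_mono_ae ?_
    filter_upwards [Measure.quasiMeasurePreserving_fst.ae h1,
      Measure.quasiMeasurePreserving_snd.ae h2] with w hw1 hw2
    rw [enorm_mul]
    gcongr
  · have hr0 : r ≠ 0 := (zero_lt_one.trans_le hr).ne'
    have hs : 1 ≤ r.toReal := by simpa using ENNReal.toReal_mono hrt hr
    have hs0 : 0 < r.toReal := zero_lt_one.trans_le hs
    rw [eLpNorm_eq_lintegral_rpow_enorm_toReal hr0 hrt, one_div,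
      ENNReal.rpow_inv_le_iff hs0]
    simp only [enorm_eq_self]
    refine lintegral_rpow_lintegral_mul_le (F := fun (w : V × V) x => ‖f (x - w.1) * g (x - w.2)‖ₑ)
      hK.enorm ?_ hs fun w => ?_
    · exact ((hf.comp_measurable (by fun_prop)).mul (hg.comp_measurable (by fun_prop))).enorm
    · have h := hbound w.1 w.2
      rwa [eLpNorm_eq_lintegral_rpow_enorm_toReal hr0 hrt, one_div,
        ENNReal.rpow_inv_le_iff hs0] at h

/-- A bilinear convolution operator with an integrable kernel maps `L^p × L^q` to `L^r`. -/
theorem memLp_bilinear_convolution {p q r : ℝ≥0∞} (hr : 1 ≤ r) (hpqr : p⁻¹ + q⁻¹ = r⁻¹)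
    {K : V × V → ℂ} (hKm : StronglyMeasurable K) (hK : ∫⁻ w, ‖K w‖ₑ ≠ ⊤) {f g : V → ℂ}
    (hf : MemLp f p volume) (hg : MemLp g q volume) :
    (∀ᵐ x : V, Integrable fun w : V × V => K w * f (x - w.1) * g (x - w.2)) ∧
      MemLp (fun x => ∫ w : V × V, K w * f (x - w.1) * g (x - w.2)) r volume ∧
      eLpNorm (fun x => ∫ w : V × V, K w * f (x - w.1) * g (x - w.2)) r volume ≤
        (∫⁻ w, ‖K w‖ₑ) * eLpNorm f p volume * eLpNorm g q volume := by
  -- Changing `f` and `g` on null sets changes neither side, not even at a single point `x`.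
  wlog hmeas : StronglyMeasurable f ∧ StronglyMeasurable g generalizing f g
  · obtain ⟨f', hf', hff'⟩ := hf.1
    obtain ⟨g', hg', hgg'⟩ := hg.1
    have h := this ((memLp_congr_ae hff').1 hf) ((memLp_congr_ae hgg').1 hg) ⟨hf', hg'⟩
    have hae : ∀ x : V, (fun w : V × V => K w * f (x - w.1) * g (x - w.2)) =ᵐ[volume]
        fun w : V × V => K w * f' (x - w.1) * g' (x - w.2) := by
      intro x
      have h1 : ∀ᵐ y : V, f (x - y) = f' (x - y) :=
        (Measure.measurePreserving_sub_left volume x).quasiMeasurePreserving.ae hff'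
      have h2 : ∀ᵐ y : V, g (x - y) = g' (x - y) :=
        (Measure.measurePreserving_sub_left volume x).quasiMeasurePreserving.ae hgg'
      filter_upwards [Measure.quasiMeasurePreserving_fst.ae h1,
        Measure.quasiMeasurePreserving_snd.ae h2] with w hw1 hw2
      rw [hw1, hw2]
    rw [eLpNorm_congr_ae hff', eLpNorm_congr_ae hgg']
    simp only [fun x => integral_congr_ae (hae x), fun x => integrable_congr (hae x)]
    exact h
  obtain ⟨hfm, hgm⟩ := hmeas
  have hmaj := eLpNorm_lintegral_bilinear_le (p := p) (q := q) hr hpqr hKm hfm hgm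
  have hfin : (∫⁻ w, ‖K w‖ₑ) * (eLpNorm f p volume * eLpNorm g q volume) < ⊤ :=
    ENNReal.mul_lt_top hK.lt_top (ENNReal.mul_lt_top hf.2 hg.2)
  have hjoint : StronglyMeasurable (Function.uncurry fun (x : V) (w : V × V) =>
      K w * f (x - w.1) * g (x - w.2)) :=
    ((hKm.comp_measurable (by fun_prop)).mul (hfm.comp_measurable (by fun_prop))).mul
      (hgm.comp_measurable (by fun_prop))
  have hH : Measurable fun x : V => ∫⁻ w : V × V, ‖K w‖ₑ * ‖f (x - w.1) * g (x - w.2)‖ₑ := by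
    have := Measurable.lintegral_prod_right' (ν := (volume : Measure (V × V))) hjoint.enorm
    simpa [mul_assoc, enorm_mul] using this
  have hle : eLpNorm (fun x => ∫ w : V × V, K w * f (x - w.1) * g (x - w.2)) r volume ≤
      (∫⁻ w, ‖K w‖ₑ) * (eLpNorm f p volume * eLpNorm g q volume) := by
    refine (eLpNorm_mono_enorm fun x => ?_).trans hmaj
    rw [enorm_eq_self]
    refine (enorm_integral_le_lintegral_enorm _).trans_eq ?_
    simp [mul_assoc, enorm_mul]
  refine ⟨?_, ⟨hjoint.integral_prod_right.aestronglyMeasurable, hle.trans_lt hfin⟩,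
    by rwa [mul_assoc]⟩
  have hr0 : r ≠ 0 := (zero_lt_one.trans_le hr).ne'
  have hlt : ∀ᵐ x : V, ∫⁻ w : V × V, ‖K w‖ₑ * ‖f (x - w.1) * g (x - w.2)‖ₑ < ⊤ := by
    have hfinH := hmaj.trans_lt hfin
    rcases eq_or_ne r ⊤ with rfl | hrt
    · rw [eLpNorm_exponent_top] at hfinH
      filter_upwards [enorm_ae_le_eLpNormEssSup (fun x : V => ∫⁻ w : V × V,
        ‖K w‖ₑ * ‖f (x - w.1) * g (x - w.2)‖ₑ) volume] with x hx
      exact hx.trans_lt hfinH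
    · have h := ae_lt_top (hH.pow_const r.toReal)
        (lintegral_rpow_enorm_lt_top_of_eLpNorm_lt_top hr0 hrt hfinH).ne
      filter_upwards [h] with x hx
      exact (ENNReal.rpow_lt_top_iff_of_pos (ENNReal.toReal_pos hr0 hrt)).1 hx
  filter_upwards [hlt] with x hx
  refine ⟨(hjoint.comp_measurable measurable_prodMk_left).aestronglyMeasurable, ?_⟩
  refine lt_of_eq_of_lt ?_ hx
  simp [mul_assoc, enorm_mul]

end BilinearConvolution

/-! ### Kernels of functions of one frequency -/

section LinearKernels

variable {V : Type*} [NormedAddCommGroup V] [InnerProductSpace ℝ V] [FiniteDimensional ℝ V]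
  [MeasurableSpace V] [BorelSpace V]

open scoped FourierTransform SchwartzMap

/-- The `L¹` norm of the inverse Fourier integral `∫ e^{i y·ξ} F(ξ) dξ`, possibly infinite. -/
noncomputable def linearKernelMass (F : V → ℂ) : ℝ≥0∞ :=
  ∫⁻ y, ‖∫ ξ, Complex.exp (Complex.I * ((inner ℝ y ξ : ℝ) : ℂ)) * F ξ‖ₑ

theorem lintegral_comp_smul_addHaar {G : V → ℝ≥0∞} (hG : Measurable G) {R : ℝ} (hR : R ≠ 0) :
    ∫⁻ y, G (R • y) = ENNReal.ofReal |(R ^ Module.finrank ℝ V)⁻¹| * ∫⁻ y, G y := by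
  rw [← lintegral_map hG (measurable_const_smul R), Measure.map_addHaar_smul _ hR,
    lintegral_smul_measure, smul_eq_mul]

theorem continuous_integral_exp_inner_mul {F : V → ℂ} (hF : Integrable F) :
    Continuous fun y => ∫ ξ, Complex.exp (Complex.I * ((inner ℝ y ξ : ℝ) : ℂ)) * F ξ := by
  refine continuous_of_dominated (bound := fun v => ‖F v‖) (fun w => ?_) (fun w => ?_) hF.norm ?_
  · exact (Continuous.aestronglyMeasurable (by fun_prop)).mul hF.1
  · refine Filter.Eventually.of_forall fun v => ?_
    rw [norm_mul, norm_exp_I_mul_ofReal, one_mul]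
  · refine Filter.Eventually.of_forall fun v => ?_
    fun_prop

/-- Kernels are normalized in `L¹`, so dilating a symbol leaves the mass of its kernel unchanged. -/
theorem linearKernelMass_comp_smul {F : V → ℂ} (hF : Integrable F) {s : ℝ} (hs : 0 < s) :
    linearKernelMass (fun ξ => F (s⁻¹ • ξ)) = linearKernelMass F := by
  set n := Module.finrank ℝ V
  have h : ∀ y : V, ∫ ξ, Complex.exp (Complex.I * ((inner ℝ y ξ : ℝ) : ℂ)) * F (s⁻¹ • ξ) =
      |((s⁻¹ : ℝ) ^ n)⁻¹| •
        ∫ ξ, Complex.exp (Complex.I * ((inner ℝ (s • y) ξ : ℝ) : ℂ)) * F ξ := by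
    intro y
    rw [← Measure.integral_comp_smul]
    congr 1
    funext ξ
    rw [inner_smul_left, inner_smul_right]
    simp [mul_inv_cancel_left₀ hs.ne']
  unfold linearKernelMass
  simp only [h, enorm_smul]
  rw [lintegral_const_mul' _ _ enorm_ne_top, lintegral_comp_smul_addHaar
    (G := fun y => ‖∫ ξ, Complex.exp (Complex.I * ((inner ℝ y ξ : ℝ) : ℂ)) * F ξ‖ₑ)
    (continuous_integral_exp_inner_mul hF).enorm.measurable hs.ne', ← mul_assoc,
    ← ofReal_norm, ← ENNReal.ofReal_mul (norm_nonneg _)]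
  have h1 : ‖|((s⁻¹ : ℝ) ^ n)⁻¹|‖ * |(s ^ n)⁻¹| = 1 := by
    rw [norm_abs_eq_norm, Real.norm_eq_abs, ← abs_mul, inv_pow, inv_inv,
      mul_inv_cancel₀ (pow_pos hs n).ne', abs_one]
  rw [h1, ENNReal.ofReal_one, one_mul]

/-- The factor `(2π)^n` comes from the `2π` in Mathlib's normalization of the phase. -/
theorem linearKernelMass_eq_fourierInv {F : V → ℂ} (hF : Integrable F) :
    linearKernelMass F =
      ENNReal.ofReal ((2 * Real.pi) ^ Module.finrank ℝ V) * ∫⁻ y, ‖𝓕⁻ F y‖ₑ := by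
  have hpi : (2 * Real.pi)⁻¹ ≠ 0 := by positivity
  have h : ∀ y : V, 𝓕⁻ F y =
      ∫ ξ, Complex.exp (Complex.I * ((inner ℝ ((2 * Real.pi) • y) ξ : ℝ) : ℂ)) * F ξ := by
    intro y
    rw [Real.fourierInv_eq']
    congr 1
    funext ξ
    rw [inner_smul_left, real_inner_comm, smul_eq_mul]
    congr 2
    simp
    ring
  simp only [h]
  rw [lintegral_comp_smul_addHaar
    (G := fun y => ‖∫ ξ, Complex.exp (Complex.I * ((inner ℝ y ξ : ℝ) : ℂ)) * F ξ‖ₑ)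
    (continuous_integral_exp_inner_mul hF).enorm.measurable (by positivity), ← mul_assoc,
    ← ENNReal.ofReal_mul (by positivity), abs_of_nonneg (by positivity),
    mul_inv_cancel₀ (by positivity), ENNReal.ofReal_one, one_mul]
  rfl

theorem kernelMass_mul_prod {F G : V → ℂ} (hF : Integrable F) (hG : Integrable G) :
    kernelMass (fun v : V × V => F v.1 * G v.2) = linearKernelMass F * linearKernelMass G := by
  have h : ∀ w : V × V, oscInt (fun v : V × V => F v.1 * G v.2) w =
      (∫ ξ, Complex.exp (Complex.I * ((inner ℝ w.1 ξ : ℝ) : ℂ)) * F ξ) *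
        ∫ ξ, Complex.exp (Complex.I * ((inner ℝ w.2 ξ : ℝ) : ℂ)) * G ξ := by
    intro w
    refine Eq.trans ?_ (integral_prod_mul (μ := (volume : Measure V)) (ν := (volume : Measure V))
      (fun ξ => Complex.exp (Complex.I * ((inner ℝ w.1 ξ : ℝ) : ℂ)) * F ξ)
      (fun ξ => Complex.exp (Complex.I * ((inner ℝ w.2 ξ : ℝ) : ℂ)) * G ξ))
    unfold oscInt
    rw [Measure.volume_eq_prod]
    congr 1
    funext v
    push_cast
    rw [mul_add, Complex.exp_add]
    ring
  unfold kernelMass linearKernelMass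
  simp only [h, enorm_mul]
  exact lintegral_prod_mul (continuous_integral_exp_inner_mul hF).enorm.measurable.aemeasurable
    (continuous_integral_exp_inner_mul hG).enorm.measurable.aemeasurable

/-- Smooth functions supported in a fixed ball have kernels whose masses are controlled by their
derivatives, uniformly in the family: the inverse Fourier transform is continuous from Schwartz
space to `L¹`. -/
theorem exists_linearKernelMass_le {ι : Type*} {F : ι → V → ℂ} {ρ : ι → ℝ} {b : ℝ}
    (hρ : ∀ i, 0 ≤ ρ i) (hsmooth : ∀ i, ContDiff ℝ ∞ (F i))
    (hsupp : ∀ i, Function.support (F i) ⊆ Metric.closedBall 0 b)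
    (hderiv : ∀ n : ℕ, ∃ D : ℝ, 0 ≤ D ∧ ∀ i x, ‖iteratedFDeriv ℝ n (F i) x‖ ≤ D * ρ i) :
    ∃ C : ℝ, 0 ≤ C ∧ ∀ i, linearKernelMass (F i) ≤ ENNReal.ofReal (C * ρ i) := by
  have hball : IsCompact (Metric.closedBall (0 : V) b) := isCompact_closedBall 0 b
  have hts : ∀ i, tsupport (F i) ⊆ Metric.closedBall 0 b := fun i =>
    closure_minimal (hsupp i) hball.isClosed
  have hcs : ∀ i, HasCompactSupport (F i) := fun i =>
    HasCompactSupport.of_support_subset_isCompact hball (hsupp i)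
  let S : ι → 𝓢(V, ℂ) := fun i => (hcs i).toSchwartzMap (hsmooth i)
  have hS : ∀ i, (S i : V → ℂ) = F i := fun i => rfl
  let T : 𝓢(V, ℂ) →L[ℝ] Lp ℂ 1 (volume : Measure V) :=
    (SchwartzMap.toLpCLM ℝ ℂ 1 volume).comp (FourierTransform.fourierInvCLM ℝ 𝓢(V, ℂ))
  obtain ⟨s, C, -, hC⟩ := Seminorm.bound_of_continuous (schwartz_withSeminorms ℝ V ℂ)
    ((normSeminorm ℝ (Lp ℂ 1 (volume : Measure V))).comp T.toLinearMap)
    (continuous_norm.comp T.continuous)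
  choose D hD0 hD using hderiv
  let B : ℝ := ∑ m ∈ s, |b| ^ m.1 * D m.2
  have hB0 : ∀ m ∈ s, 0 ≤ |b| ^ m.1 * D m.2 := fun m _ => mul_nonneg (by positivity) (hD0 _)
  have hBs : 0 ≤ B := Finset.sum_nonneg hB0
  have hsem : ∀ i, s.sup (schwartzSeminormFamily ℝ V ℂ) (S i) ≤ B * ρ i := by
    intro i
    refine Seminorm.finset_sup_apply_le (mul_nonneg hBs (hρ i)) fun m hm => ?_
    have hle : |b| ^ m.1 * D m.2 * ρ i ≤ B * ρ i :=
      mul_le_mul_of_nonneg_right (Finset.single_le_sum hB0 hm) (hρ i)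
    refine le_trans (SchwartzMap.seminorm_le_bound ℝ m.1 m.2 (S i)
      (mul_nonneg (hB0 m hm) (hρ i)) fun x => ?_) hle
    rw [hS]
    by_cases hx : x ∈ tsupport (F i)
    · have hxb : ‖x‖ ≤ |b| := (mem_closedBall_zero_iff.1 (hts i hx)).trans (le_abs_self b)
      rw [mul_assoc]
      gcongr
      exact hD _ i x
    · have h0 : iteratedFDeriv ℝ m.2 (F i) x = 0 :=
        Function.notMem_support.1 fun h => hx (support_iteratedFDeriv_subset m.2 h)
      rw [h0, norm_zero, mul_zero]
      exact mul_nonneg (hB0 m hm) (hρ i)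
  refine ⟨(2 * Real.pi) ^ Module.finrank ℝ V * (C * B), by positivity, fun i => ?_⟩
  have hint : Integrable (F i) := (hsmooth i).continuous.integrable_of_hasCompactSupport (hcs i)
  have hT : ‖T (S i)‖ ≤ C * (B * ρ i) := by
    refine (hC (S i)).trans ?_
    exact mul_le_mul_of_nonneg_left (hsem i) C.coe_nonneg
  have hTn : ‖T (S i)‖ = ∫ y, ‖𝓕⁻ (F i) y‖ := by
    have : T (S i) = (𝓕⁻ (S i)).toLp 1 volume := rfl
    rw [this, SchwartzMap.norm_toLp_one, SchwartzMap.fourierInv_coe, hS]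
  have hFi : Integrable (𝓕⁻ (F i)) := by
    rw [← hS, ← SchwartzMap.fourierInv_coe]
    exact SchwartzMap.integrable _
  rw [linearKernelMass_eq_fourierInv hint, ← ofReal_integral_norm_eq_lintegral_enorm hFi,
    ← ENNReal.ofReal_mul (by positivity), ← hTn]
  refine ENNReal.ofReal_le_ofReal ?_
  rw [mul_assoc, mul_assoc]
  gcongr

end LinearKernels

/-! ### Exponentials of the norm on an annulus -/

section NormExponential

variable {V : Type*} [NormedAddCommGroup V] [InnerProductSpace ℝ V] [FiniteDimensional ℝ V]

/-- The norm agrees outside any neighbourhood of the origin with a smooth function. -/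
theorem exists_contDiff_eq_norm {a : ℝ} (ha : 0 < a) :
    ∃ g : V → ℝ, ContDiff ℝ ∞ g ∧ ∀ x, a ≤ ‖x‖ → g x = ‖x‖ := by
  let χ : ContDiffBump (0 : V) := ⟨a / 2, a, by positivity, by linarith⟩
  refine ⟨fun x => (1 - χ x) * ‖x‖, contDiff_iff_contDiffAt.2 fun x => ?_, fun x hx => ?_⟩
  · rcases eq_or_ne x 0 with rfl | hx
    · have h : (fun x : V => (1 - χ x) * ‖x‖) =ᶠ[nhds 0] fun _ => 0 := by
        filter_upwards [χ.eventuallyEq_one] with y hy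
        rw [hy]
        simp
      exact contDiffAt_const.congr_of_eventuallyEq h
    · exact (contDiffAt_const.sub χ.contDiff.contDiffAt).mul (contDiffAt_norm ℝ hx)
  · simp only
    rw [χ.zero_of_le_dist (by simpa using hx)]
    simp

theorem exists_forall_norm_iteratedFDeriv_le {W : Type*} [NormedAddCommGroup W] [NormedSpace ℝ W]
    {g : W → ℝ} (hg : ContDiff ℝ ∞ g) {K : Set W} (hK : IsCompact K) (n : ℕ) :
    ∃ D : ℝ, 1 ≤ D ∧ ∀ i ≤ n, ∀ x ∈ K, ‖iteratedFDeriv ℝ i g x‖ ≤ D := by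
  have h : ∀ i : ℕ, ∃ D : ℝ, ∀ x ∈ K, ‖iteratedFDeriv ℝ i g x‖ ≤ D := fun i =>
    hK.exists_bound_of_continuousOn
      (hg.continuous_iteratedFDeriv (mod_cast le_top)).continuousOn
  choose D hD using h
  refine ⟨1 + ∑ i ∈ Finset.range (n + 1), |D i|, ?_, fun i hi x hx => ?_⟩
  · have : 0 ≤ ∑ i ∈ Finset.range (n + 1), |D i| := Finset.sum_nonneg fun i _ => abs_nonneg _
    linarith
  · have h1 : |D i| ≤ ∑ i ∈ Finset.range (n + 1), |D i| :=
      Finset.single_le_sum (f := fun i => |D i|) (fun i _ => abs_nonneg _)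
        (Finset.mem_range.2 (Nat.lt_succ_of_le hi))
    linarith [hD i x hx, le_abs_self (D i)]

/-- Half of the exponential decay absorbs any power of the parameter. -/
theorem pow_mul_exp_neg_le {a τ u : ℝ} (ha : 0 < a) (hτ : 0 ≤ τ) (hu : a ≤ u) (j : ℕ) :
    τ ^ j * Real.exp (-τ * u) ≤ (j.factorial * (2 / a) ^ j) * Real.exp (-(τ * (a / 2))) := by
  have h1 : (τ * (a / 2)) ^ j ≤ j.factorial * Real.exp (τ * (a / 2)) := by
    have := Real.pow_div_factorial_le_exp (τ * (a / 2)) (by positivity) j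
    rwa [div_le_iff₀ (by positivity), mul_comm (Real.exp _)] at this
  have h2 : τ ^ j = (2 / a) ^ j * (τ * (a / 2)) ^ j := by
    rw [← mul_pow]
    congr 1
    field_simp
  calc τ ^ j * Real.exp (-τ * u)
      ≤ (2 / a) ^ j * (j.factorial * Real.exp (τ * (a / 2))) * Real.exp (-(τ * a)) := by
        rw [h2]
        gcongr
        nlinarith
    _ = _ := by
        have : Real.exp (-(τ * (a / 2))) = Real.exp (τ * (a / 2)) * Real.exp (-(τ * a)) := by
          rw [← Real.exp_add]
          congr 1
          ring
        rw [this]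
        ring

/-- Every derivative of `e^{-τ g} f` decays like `e^{-τ a / 2}`: it brings out powers of `τ`, which
half of the decay `e^{-τ a}` on the support absorbs. -/
theorem exists_norm_iteratedFDeriv_exp_neg_norm_mul_le {f : V → ℝ} (hf : ContDiff ℝ ∞ f) {a b : ℝ}
    (ha : 0 < a) (hsupp : Function.support f ⊆ {x | a ≤ ‖x‖ ∧ ‖x‖ ≤ b}) {g : V → ℝ}
    (hg : ContDiff ℝ ∞ g) (hgn : ∀ x, a ≤ ‖x‖ → g x = ‖x‖) (n : ℕ) :
    ∃ D : ℝ, 0 ≤ D ∧ ∀ (τ : ℝ), 0 ≤ τ → ∀ x : V,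
      ‖iteratedFDeriv ℝ n (fun y => Real.exp (-τ * g y) * f y) x‖ ≤
        D * Real.exp (-(τ * (a / 2))) := by
  set K : Set V := {x | a ≤ ‖x‖ ∧ ‖x‖ ≤ b} with hKdef
  have hKcl : IsClosed K := (isClosed_le continuous_const continuous_norm).inter
    (isClosed_le continuous_norm continuous_const)
  have hK : IsCompact K := (isCompact_closedBall (0 : V) b).of_isClosed_subset hKcl
    fun x hx => mem_closedBall_zero_iff.2 hx.2
  obtain ⟨G, hG1, hG⟩ := exists_forall_norm_iteratedFDeriv_le hg hK n
  obtain ⟨Q, hQ1, hQ⟩ := exists_forall_norm_iteratedFDeriv_le hf hK n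
  let P : ℝ := ∑ j ∈ Finset.range (n + 1), j.factorial * (2 / a) ^ j
  have hP : ∀ j ≤ n, (j.factorial * (2 / a) ^ j : ℝ) ≤ P := fun j hj =>
    Finset.single_le_sum (f := fun j : ℕ => (j.factorial * (2 / a) ^ j : ℝ))
      (fun j _ => by positivity) (Finset.mem_range.2 (Nat.lt_succ_of_le hj))
  have hP0 : 0 ≤ P := Finset.sum_nonneg fun j _ => by positivity
  let D : ℝ := ∑ i ∈ Finset.range (n + 1), (n.choose i : ℝ) * (i.factorial * P * G ^ i) * Q
  have hD0 : 0 ≤ D := Finset.sum_nonneg fun i _ => by positivity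
  refine ⟨D, hD0, fun τ hτ x => ?_⟩
  have hexp : ContDiff ℝ ∞ fun y => Real.exp (-τ * g y) := (contDiff_const.mul hg).exp
  by_cases hx : x ∈ tsupport f
  · have hxK : x ∈ K := closure_minimal hsupp hKcl hx
    refine (norm_iteratedFDeriv_mul_le hexp hf x (mod_cast le_top)).trans ?_
    rw [Finset.sum_mul]
    refine Finset.sum_le_sum fun i hi => ?_
    have hin : i ≤ n := Nat.lt_succ_iff.1 (Finset.mem_range.1 hi)
    have hcomp : ‖iteratedFDeriv ℝ i (fun y => Real.exp (-τ * g y)) x‖ ≤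
        i.factorial * (P * Real.exp (-(τ * (a / 2)))) * G ^ i := by
      refine norm_iteratedFDeriv_comp_le (g := fun u : ℝ => Real.exp (-τ * u)) (f := g) (N := ∞)
        (by fun_prop) hg (mod_cast le_top) x (fun j hj => ?_) fun j hj1 hj => ?_
      · rw [norm_iteratedFDeriv_eq_norm_iteratedDeriv, iteratedDeriv_exp_const_mul, norm_mul,
          norm_pow, norm_neg, Real.norm_of_nonneg hτ, Real.norm_of_nonneg (Real.exp_nonneg _),
          hgn x hxK.1]
        refine (pow_mul_exp_neg_le ha hτ hxK.1 j).trans ?_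
        gcongr
        exact hP j (hj.trans hin)
      · exact (hG j (hj.trans hin) x hxK).trans (le_self_pow₀ hG1 (by omega))
    calc (n.choose i : ℝ) * ‖iteratedFDeriv ℝ i (fun y => Real.exp (-τ * g y)) x‖ *
          ‖iteratedFDeriv ℝ (n - i) f x‖
        ≤ (n.choose i : ℝ) * (i.factorial * (P * Real.exp (-(τ * (a / 2)))) * G ^ i) * Q := by
          gcongr
          exact hQ _ (Nat.sub_le n i) x hxK
      _ = _ := by ring
  · have h0 : iteratedFDeriv ℝ n (fun y => Real.exp (-τ * g y) * f y) x = 0 := by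
      refine Function.notMem_support.1 fun h => hx ?_
      exact closure_mono (fun y hy => right_ne_zero_of_mul hy)
        (support_iteratedFDeriv_subset n h)
    rw [h0, norm_zero]
    positivity

variable [MeasurableSpace V] [BorelSpace V]

/-- For a smooth `f` supported in the annulus `a ≤ |ξ| ≤ b`, the kernel of `e^{-τ|ξ|} f(ξ)` decays
exponentially in `τ`, at half of the rate of the symbol. -/
theorem exists_linearKernelMass_exp_neg_norm_mul_le {f : V → ℝ} (hf : ContDiff ℝ ∞ f) {a b : ℝ}
    (ha : 0 < a) (hsupp : Function.support f ⊆ {x | a ≤ ‖x‖ ∧ ‖x‖ ≤ b}) :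
    ∃ C : ℝ, 0 ≤ C ∧ ∀ τ : ℝ, 0 ≤ τ →
      linearKernelMass (fun ξ => ((Real.exp (-τ * ‖ξ‖) * f ξ : ℝ) : ℂ)) ≤
        ENNReal.ofReal (C * Real.exp (-(τ * (a / 2)))) := by
  obtain ⟨g, hg, hgn⟩ := exists_contDiff_eq_norm (V := V) ha
  have heq : ∀ (τ : ℝ) (ξ : V), Real.exp (-τ * ‖ξ‖) * f ξ = Real.exp (-τ * g ξ) * f ξ := by
    intro τ ξ
    by_cases h : f ξ = 0
    · simp [h]
    · rw [hgn ξ (hsupp h).1]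
  have hsm : ∀ τ : ℝ, ContDiff ℝ ∞ fun y => Real.exp (-τ * g y) * f y := fun τ =>
    (contDiff_const.mul hg).exp.mul hf
  have hball : ∀ τ : {τ : ℝ // 0 ≤ τ}, Function.support
      (fun ξ => ((Real.exp (-τ.1 * g ξ) * f ξ : ℝ) : ℂ)) ⊆ Metric.closedBall 0 b := fun τ x hx =>
    mem_closedBall_zero_iff.2 (hsupp (right_ne_zero_of_mul (Complex.ofReal_ne_zero.1 hx))).2
  have hderiv : ∀ n : ℕ, ∃ D : ℝ, 0 ≤ D ∧ ∀ (τ : {τ : ℝ // 0 ≤ τ}) (x : V),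
      ‖iteratedFDeriv ℝ n (fun ξ => ((Real.exp (-τ.1 * g ξ) * f ξ : ℝ) : ℂ)) x‖ ≤
        D * Real.exp (-(τ.1 * (a / 2))) := by
    intro n
    obtain ⟨D, hD0, hD⟩ :=
      exists_norm_iteratedFDeriv_exp_neg_norm_mul_le hf ha hsupp hg hgn n
    refine ⟨D, hD0, fun τ x => le_trans (le_of_eq ?_) (hD τ.1 τ.2 x)⟩
    exact Complex.ofRealLI.norm_iteratedFDeriv_comp_left (hsm τ.1).contDiffAt (mod_cast le_top)
  have hsmooth : ∀ τ : {τ : ℝ // 0 ≤ τ}, ContDiff ℝ ∞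
      (fun ξ => ((Real.exp (-τ.1 * g ξ) * f ξ : ℝ) : ℂ)) := fun τ =>
    Complex.ofRealCLM.contDiff.comp (hsm τ.1)
  obtain ⟨C, hC0, hC⟩ := exists_linearKernelMass_le
    (F := fun (τ : {τ : ℝ // 0 ≤ τ}) ξ => ((Real.exp (-τ.1 * g ξ) * f ξ : ℝ) : ℂ))
    (ρ := fun τ => Real.exp (-(τ.1 * (a / 2)))) (fun τ => (Real.exp_pos _).le)
    hsmooth hball hderiv
  refine ⟨C, hC0, fun τ hτ => ?_⟩
  simp only [heq]
  exact hC ⟨τ, hτ⟩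

end NormExponential

/-! ### The singularity of the norm at the origin -/

section ConeSingularity

variable {V : Type*} [NormedAddCommGroup V] [InnerProductSpace ℝ V] [FiniteDimensional ℝ V]
  [MeasurableSpace V] [BorelSpace V]

open scoped FourierTransform SchwartzMap

/-- A smooth compactly supported function of `s (ξ + η)` is a multiplier whose norm does not depend
on `s`, by Fourier inversion. -/
theorem exists_isMassMultiplier_comp_smul_add {θ : V → ℝ} (hθ : ContDiff ℝ ∞ θ)
    (hcs : HasCompactSupport θ) :
    ∃ A : ℝ, ∀ s : ℝ, IsMassMultiplier (fun v : V × V => (θ (s • (v.1 + v.2)) : ℂ)) A := by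
  have hθc : ContDiff ℝ ∞ fun x => (θ x : ℂ) := Complex.ofRealCLM.contDiff.comp hθ
  have hcsc : HasCompactSupport fun x => (θ x : ℂ) := hcs.comp_left Complex.ofReal_zero
  let S : 𝓢(V, ℂ) := hcsc.toSchwartzMap hθc
  refine ⟨∫ y, ‖𝓕 S y‖, fun s => ?_⟩
  have h := IsMassMultiplier.of_integral (𝓕 S).integrable (2 * Real.pi * s)
  have heq : (fun v : V × V => (θ (s • (v.1 + v.2)) : ℂ)) = fun v : V × V =>
      ∫ y, Complex.exp (Complex.I * ((2 * Real.pi * s * inner ℝ y (v.1 + v.2) : ℝ) : ℂ)) *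
        𝓕 S y := by
    funext v
    have hS : (θ (s • (v.1 + v.2)) : ℂ) = (𝓕⁻ (𝓕 S)) (s • (v.1 + v.2)) := by
      rw [FourierTransform.fourierInv_fourier_eq]
      rfl
    rw [hS, SchwartzMap.fourierInv_coe, Real.fourierInv_eq']
    congr 1
    funext y
    rw [inner_smul_right, smul_eq_mul]
    congr 2
    push_cast
    ring
  rw [heq]
  exact h

/-- Up to a cutoff, `|ξ + η|` is a multiplier although it is not smooth: it is the sum of its
dyadic pieces `2^{-j} θ(2^j (ξ + η))`, where `θ` is smooth, and their norms decay geometrically. -/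
theorem exists_isMassMultiplier_norm_add {R : ℝ} (hR : 0 < R) :
    ∃ A : ℝ, ∃ h : V → ℝ, (∀ ζ, ‖ζ‖ ≤ R → h ζ = ‖ζ‖) ∧
      ∀ s : ℝ, IsMassMultiplier (fun v : V × V => (h (s • (v.1 + v.2)) : ℂ)) A := by
  let χ : ContDiffBump (0 : V) := ⟨R, 2 * R, hR, by linarith⟩
  have hχ0 : ∀ x : V, 2 * R ≤ ‖x‖ → χ x = 0 := fun x hx => χ.zero_of_le_dist (by simpa using hx)
  have hχ1 : ∀ x : V, ‖x‖ ≤ R → χ x = 1 := fun x hx =>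
    χ.one_of_mem_closedBall (mem_closedBall_zero_iff.2 hx)
  have h2 : ∀ x : V, ‖(2 : ℝ) • x‖ = 2 * ‖x‖ := fun x => by
    rw [norm_smul, Real.norm_of_nonneg zero_le_two]
  let θ : V → ℝ := fun x => ‖x‖ * (χ x - χ ((2 : ℝ) • x))
  obtain ⟨g, hg, hgn⟩ := exists_contDiff_eq_norm (V := V) (half_pos hR)
  have hθg : θ = fun x => g x * (χ x - χ ((2 : ℝ) • x)) := by
    funext x
    rcases le_total (R / 2) ‖x‖ with hx | hx
    · simp only [θ, hgn x hx]
    · have h0 : χ x - χ ((2 : ℝ) • x) = 0 := by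
        rw [hχ1 x (by linarith), hχ1 _ (by rw [h2]; linarith), sub_self]
      simp only [θ, h0, mul_zero]
  have hθ : ContDiff ℝ ∞ θ := by
    rw [hθg]
    exact hg.mul (χ.contDiff.sub (χ.contDiff.comp (contDiff_const_smul (2 : ℝ))))
  have hcs : HasCompactSupport θ := by
    refine HasCompactSupport.of_support_subset_isCompact (isCompact_closedBall (0 : V) (2 * R)) ?_
    intro x hx
    by_contra hxb
    rw [mem_closedBall_zero_iff, not_le] at hxb
    refine hx ?_
    simp only [θ]
    rw [hχ0 x hxb.le, hχ0 _ (by rw [h2]; linarith), sub_zero, mul_zero]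
  obtain ⟨A, hA⟩ := exists_isMassMultiplier_comp_smul_add hθ hcs
  refine ⟨2 * A, fun x => ‖x‖ * χ x, fun ζ hζ => by simp only [hχ1 ζ hζ, mul_one], fun s => ?_⟩
  have hterm : ∀ j : ℕ, IsMassMultiplier
      (fun v : V × V => (((1 / 2 : ℝ) ^ j : ℝ) : ℂ) * (θ ((2 ^ j * s) • (v.1 + v.2)) : ℂ))
      ((1 / 2) ^ j * A) := fun j => (hA (2 ^ j * s)).const_mul (by positivity)
  have hsum : HasSum (fun j : ℕ => (1 / 2 : ℝ) ^ j * A) (2 * A) :=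
    hasSum_geometric_two.mul_right A
  refine IsMassMultiplier.hasSum hterm hsum fun v => ?_
  have hsummable : Summable fun j : ℕ =>
      (((1 / 2 : ℝ) ^ j : ℝ) : ℂ) * (θ ((2 ^ j * s) • (v.1 + v.2)) : ℂ) :=
    Summable.of_norm_bounded hsum.summable fun j => (hterm j).norm_le v
  refine hsummable.hasSum_iff_tendsto_nat.2 ?_
  set ζ : V := s • (v.1 + v.2)
  -- The partial sums telescope to `|ζ| (χ(ζ) - χ(2^N ζ))`.
  have htel : ∀ N : ℕ, ∑ j ∈ Finset.range N,
      (((1 / 2 : ℝ) ^ j : ℝ) : ℂ) * (θ ((2 ^ j * s) • (v.1 + v.2)) : ℂ) =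
        ((‖ζ‖ * χ ζ - ‖ζ‖ * χ ((2 : ℝ) ^ N • ζ) : ℝ) : ℂ) := by
    intro N
    have hj : ∀ j : ℕ, (1 / 2 : ℝ) ^ j * θ ((2 ^ j * s) • (v.1 + v.2)) =
        ‖ζ‖ * χ ((2 : ℝ) ^ j • ζ) - ‖ζ‖ * χ ((2 : ℝ) ^ (j + 1) • ζ) := by
      intro j
      have e1 : (2 ^ j * s) • (v.1 + v.2) = (2 : ℝ) ^ j • ζ := mul_smul _ _ _
      have e2 : (2 : ℝ) • (2 : ℝ) ^ j • ζ = (2 : ℝ) ^ (j + 1) • ζ := by rw [smul_smul, pow_succ']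
      have e3 : (1 / 2 : ℝ) ^ j * 2 ^ j = 1 := by rw [← mul_pow]; norm_num
      simp only [θ]
      rw [e1, e2, norm_smul, Real.norm_of_nonneg (by positivity : (0 : ℝ) ≤ 2 ^ j), ← mul_assoc,
        ← mul_assoc, e3, one_mul, mul_sub]
    have hsumr := Finset.sum_range_sub' (fun j : ℕ => ‖ζ‖ * χ ((2 : ℝ) ^ j • ζ)) N
    simp only [← hj, pow_zero, one_smul] at hsumr
    rw [← hsumr]
    push_cast
    rfl
  simp only [htel]
  refine tendsto_const_nhds.congr' ?_
  rcases eq_or_ne ζ 0 with h0 | h0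
  · simp [h0]
  · have hlim : Filter.Tendsto (fun N : ℕ => (2 : ℝ) ^ N * ‖ζ‖) Filter.atTop Filter.atTop :=
      (tendsto_pow_atTop_atTop_of_one_lt one_lt_two).atTop_mul_const (norm_pos_iff.2 h0)
    filter_upwards [hlim.eventually_ge_atTop (2 * R)] with N hN
    rw [hχ0 ((2 : ℝ) ^ N • ζ) (by rwa [norm_smul, Real.norm_of_nonneg (by positivity)]),
      mul_zero, sub_zero]

end ConeSingularity

/-! ### The localized Gevrey symbol -/

section GevreySymbol

/-- On the support of the cutoffs, the localized symbol is a product of functions of `ξ / ℓ₁` and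
`η / ℓ₂` with the exponential of a function `h` of `(ξ + η) / ℓ₂` that agrees with the norm on a
large ball. -/
theorem localizedSymbol_gevreySymbol_eq {d : ℕ} {a b k c c₁ c₂ γ ℓ₁ ℓ₂ : ℝ} (hℓ₁ : 0 < ℓ₁)
    (hℓ₂ : 0 < ℓ₂) (hb : 0 ≤ b) (hℓ : ℓ₁ ≤ k * ℓ₂) {φ ψ h : EuclideanSpace ℝ (Fin d) → ℝ}
    (hφ : Function.support φ ⊆ annulus d a b) (hψ : Function.support ψ ⊆ annulus d a b)
    (hh : ∀ ζ, ‖ζ‖ ≤ (k + 1) * b → h ζ = ‖ζ‖) :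
    localizedSymbol (gevreySymbol γ c c₁ c₂) φ ψ ℓ₁ ℓ₂ =
      fun v => Complex.exp ((γ * c * ℓ₂ : ℝ) * (h (ℓ₂⁻¹ • (v.1 + v.2)) : ℂ)) *
        (((Real.exp (-(γ * c₁ * ℓ₁) * ‖ℓ₁⁻¹ • v.1‖) * φ (ℓ₁⁻¹ • v.1) : ℝ) : ℂ) *
          ((Real.exp (-(γ * c₂ * ℓ₂) * ‖ℓ₂⁻¹ • v.2‖) * ψ (ℓ₂⁻¹ • v.2) : ℝ) : ℂ)) := by
  funext v
  unfold localizedSymbol gevreySymbol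
  by_cases h1 : φ (ℓ₁⁻¹ • v.1) = 0
  · simp [h1]
  by_cases h2 : ψ (ℓ₂⁻¹ • v.2) = 0
  · simp [h2]
  have hn : ∀ {s : ℝ} (_ : 0 < s) (x : EuclideanSpace ℝ (Fin d)), ‖s⁻¹ • x‖ = s⁻¹ * ‖x‖ :=
    fun hs x => by rw [norm_smul, Real.norm_of_nonneg (inv_nonneg.2 hs.le)]
  have hv1 : ‖v.1‖ ≤ ℓ₁ * b := by
    have := (hφ h1).2
    rwa [hn hℓ₁, inv_mul_le_iff₀ hℓ₁] at this
  have hv2 : ‖v.2‖ ≤ ℓ₂ * b := by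
    have := (hψ h2).2
    rwa [hn hℓ₂, inv_mul_le_iff₀ hℓ₂] at this
  have hsum : ‖ℓ₂⁻¹ • (v.1 + v.2)‖ ≤ (k + 1) * b := by
    rw [hn hℓ₂, inv_mul_le_iff₀ hℓ₂]
    have := norm_add_le v.1 v.2
    nlinarith [mul_le_mul_of_nonneg_right hℓ hb]
  rw [hh _ hsum, hn hℓ₁, hn hℓ₂, hn hℓ₂]
  have hexp : Real.exp (γ * (c * ‖v.1 + v.2‖ - c₁ * ‖v.1‖ - c₂ * ‖v.2‖)) =
      Real.exp (γ * c * ℓ₂ * (ℓ₂⁻¹ * ‖v.1 + v.2‖)) *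
        (Real.exp (-(γ * c₁ * ℓ₁) * (ℓ₁⁻¹ * ‖v.1‖)) *
          Real.exp (-(γ * c₂ * ℓ₂) * (ℓ₂⁻¹ * ‖v.2‖))) := by
    rw [← Real.exp_add, ← Real.exp_add]
    congr 1
    field_simp
    ring
  rw [hexp]
  push_cast
  ring

/-- The kernels of the localized Gevrey symbols have bounded mass as soon as `c₂` is large enough
for the decay in `|η|` to beat the growth in `|ξ + η|`. -/
theorem exists_kernelMass_localizedSymbol_le {d : ℕ} {a b k c c₁ : ℝ} (ha : 0 < a) (hb : 0 < b)
    (hk : 0 < k) (hc : 0 < c) (hc₁ : 0 < c₁) :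
    ∃ M : ℝ, 0 < M ∧ ∀ c₂ : ℝ, M ≤ c₂ → ∀ φ ψ : EuclideanSpace ℝ (Fin d) → ℝ,
      ContDiff ℝ ∞ φ → Function.support φ ⊆ annulus d a b →
      ContDiff ℝ ∞ ψ → Function.support ψ ⊆ annulus d a b →
      ∃ C : ℝ≥0, ∀ γ ℓ₁ ℓ₂ : ℝ, 0 ≤ γ → 0 < ℓ₁ → 0 < ℓ₂ → ℓ₁ ≤ k * ℓ₂ →
        Integrable (localizedSymbol (gevreySymbol γ c c₁ c₂) φ ψ ℓ₁ ℓ₂) ∧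
          kernelMass (localizedSymbol (gevreySymbol γ c c₁ c₂) φ ψ ℓ₁ ℓ₂) ≤ C := by
  obtain ⟨A, h, hh, hmul⟩ := exists_isMassMultiplier_norm_add
    (V := EuclideanSpace ℝ (Fin d)) (R := (k + 1) * b) (by positivity)
  have hA : 0 ≤ A := (hmul 0).nonneg
  -- The exponential of `γ c ℓ₂ h` costs `e^{γ c ℓ₂ A}`, and the factor in `η` gains
  -- `e^{-γ c₂ ℓ₂ a / 2}`; hence the threshold `2 c A / a`, enlarged to make it positive.
  refine ⟨2 * c * A / a + 1, by positivity, fun c₂ hc₂ φ ψ hφ hφs hψ hψs => ?_⟩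
  have hc₂A : c * A ≤ c₂ * (a / 2) := by
    have h1 : 2 * c * A / a ≤ c₂ := by linarith
    rw [div_le_iff₀ ha] at h1
    linarith
  have hc₂0 : 0 ≤ c₂ := le_trans (by positivity) hc₂
  obtain ⟨C₁, hC₁, hm₁⟩ := exists_linearKernelMass_exp_neg_norm_mul_le hφ ha hφs
  obtain ⟨C₂, hC₂, hm₂⟩ := exists_linearKernelMass_exp_neg_norm_mul_le hψ ha hψs
  have hint : ∀ f : EuclideanSpace ℝ (Fin d) → ℝ, ContDiff ℝ ∞ f →
      Function.support f ⊆ annulus d a b → ∀ τ : ℝ,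
      Integrable fun ξ => ((Real.exp (-τ * ‖ξ‖) * f ξ : ℝ) : ℂ) := by
    intro f hf hfs τ
    have hfc := hf.continuous
    refine Continuous.integrable_of_hasCompactSupport (by fun_prop) ?_
    refine HasCompactSupport.of_support_subset_isCompact (isCompact_closedBall 0 b) fun x hx => ?_
    exact mem_closedBall_zero_iff.2 (hfs (right_ne_zero_of_mul (Complex.ofReal_ne_zero.1 hx))).2
  refine ⟨(C₁ * C₂).toNNReal, fun γ ℓ₁ ℓ₂ hγ hℓ₁ hℓ₂ hℓ => ?_⟩
  rw [localizedSymbol_gevreySymbol_eq hℓ₁ hℓ₂ hb.le hℓ hφs hψs hh]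
  have hi₁ := hint φ hφ hφs (γ * c₁ * ℓ₁)
  have hi₂ := hint ψ hψ hψs (γ * c₂ * ℓ₂)
  have hi₁' := hi₁.comp_smul (inv_ne_zero hℓ₁.ne')
  have hi₂' := hi₂.comp_smul (inv_ne_zero hℓ₂.ne')
  have hi := hi₁'.mul_prod hi₂'
  have hexp := (hmul ℓ₂⁻¹).exp (t := γ * c * ℓ₂) (by positivity)
  refine ⟨hexp.integrable_mul hi, (hexp.mass_le _ hi).trans ?_⟩
  rw [kernelMass_mul_prod hi₁' hi₂', linearKernelMass_comp_smul hi₁ hℓ₁,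
    linearKernelMass_comp_smul hi₂ hℓ₂]
  have e₁ : Real.exp (-(γ * c₁ * ℓ₁ * (a / 2))) ≤ 1 :=
    Real.exp_le_one_iff.2 (neg_nonpos.2 (by positivity))
  have e₂ : Real.exp (γ * c * ℓ₂ * A) * Real.exp (-(γ * c₂ * ℓ₂ * (a / 2))) ≤ 1 := by
    rw [← Real.exp_add, Real.exp_le_one_iff]
    have := mul_le_mul_of_nonneg_left hc₂A (mul_nonneg hγ hℓ₂.le)
    linarith
  calc ENNReal.ofReal (Real.exp (γ * c * ℓ₂ * A)) * (_ * _)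
      ≤ ENNReal.ofReal (Real.exp (γ * c * ℓ₂ * A)) *
          (ENNReal.ofReal (C₁ * Real.exp (-(γ * c₁ * ℓ₁ * (a / 2)))) *
            ENNReal.ofReal (C₂ * Real.exp (-(γ * c₂ * ℓ₂ * (a / 2))))) := by
        gcongr
        · exact hm₁ _ (by positivity)
        · exact hm₂ _ (by positivity)
    _ = ENNReal.ofReal (C₁ * C₂ * (Real.exp (-(γ * c₁ * ℓ₁ * (a / 2))) *
          (Real.exp (γ * c * ℓ₂ * A) * Real.exp (-(γ * c₂ * ℓ₂ * (a / 2)))))) := by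
        rw [← ENNReal.ofReal_mul (by positivity), ← ENNReal.ofReal_mul (by positivity)]
        congr 1
        ring
    _ ≤ ENNReal.ofReal (C₁ * C₂) := by
        refine ENNReal.ofReal_le_ofReal (mul_le_of_le_one_right (by positivity) ?_)
        exact mul_le_one₀ e₁ (by positivity) e₂

end GevreySymbol

theorem mainTheorem4 (d : ℕ) (a b k c c₁ : ℝ) (ha : 0 < a) (hab : a < b) (hk : 0 < k)
    (hc : 0 < c) (hc₁ : 0 < c₁) :
    ∃ M : ℝ, 0 < M ∧ ∀ c₂ : ℝ, M ≤ c₂ →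
      ∀ φ ψ : EuclideanSpace ℝ (Fin d) → ℝ,
        ContDiff ℝ ∞ φ → Function.support φ ⊆ annulus d a b →
        ContDiff ℝ ∞ ψ → Function.support ψ ⊆ annulus d a b →
      ∀ p q r : ℝ≥0∞, 1 ≤ p → 1 ≤ q → 1 ≤ r → p⁻¹ + q⁻¹ = r⁻¹ →
      ∃ C : ℝ≥0, ∀ γ ℓ₁ ℓ₂ : ℝ, 0 ≤ γ → 0 < ℓ₁ → 0 < ℓ₂ → ℓ₁ ≤ k * ℓ₂ →
        ∀ f g : EuclideanSpace ℝ (Fin d) → ℂ, MemLp f p volume → MemLp g q volume →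
          (∀ᵐ x : EuclideanSpace ℝ (Fin d),
            Integrable (fun w : EuclideanSpace ℝ (Fin d) × EuclideanSpace ℝ (Fin d) =>
              bilinearKernel (localizedSymbol (gevreySymbol γ c c₁ c₂) φ ψ ℓ₁ ℓ₂) w *
                f (x - w.1) * g (x - w.2))) ∧
          MemLp (bilinearMultiplier
            (localizedSymbol (gevreySymbol γ c c₁ c₂) φ ψ ℓ₁ ℓ₂) f g) r volume ∧
          eLpNorm (bilinearMultiplier
            (localizedSymbol (gevreySymbol γ c c₁ c₂) φ ψ ℓ₁ ℓ₂) f g) r volume ≤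
              C * eLpNorm f p volume * eLpNorm g q volume := by
  obtain ⟨M, hM, hmass⟩ :=
    exists_kernelMass_localizedSymbol_le (d := d) ha (ha.trans hab) hk hc hc₁
  refine ⟨M, hM, fun c₂ hc₂ φ ψ hφ hφs hψ hψs p q r _ _ hr hpqr => ?_⟩
  obtain ⟨C, hC⟩ := hmass c₂ hc₂ φ ψ hφ hφs hψ hψs
  set κ : ℂ := (((2 * Real.pi) ^ (2 * d) : ℝ) : ℂ)⁻¹ with hκ
  refine ⟨‖κ‖₊ * C, fun γ ℓ₁ ℓ₂ hγ hℓ₁ hℓ₂ hℓ f g hf hg => ?_⟩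
  obtain ⟨hint, hle⟩ := hC γ ℓ₁ ℓ₂ hγ hℓ₁ hℓ₂ hℓ
  set σ := localizedSymbol (gevreySymbol γ c c₁ c₂) φ ψ ℓ₁ ℓ₂
  have hK : bilinearKernel σ = fun w => κ * oscInt σ w := rfl
  have hKm : StronglyMeasurable (bilinearKernel σ) := by
    rw [hK]
    exact (continuous_const.mul (continuous_oscInt hint)).stronglyMeasurable
  have hKle : ∫⁻ w, ‖bilinearKernel σ w‖ₑ ≤ ((‖κ‖₊ * C : ℝ≥0) : ℝ≥0∞) := by
    simp only [hK, enorm_mul]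
    rw [lintegral_const_mul' _ _ enorm_ne_top, ENNReal.coe_mul]
    exact mul_le_mul_right hle _
  obtain ⟨h1, h2, h3⟩ := memLp_bilinear_convolution hr hpqr hKm
    (hKle.trans_lt ENNReal.coe_lt_top).ne hf hg
  refine ⟨h1, h2, h3.trans ?_⟩
  gcongr
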